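/- All Hilbert modules are right Hilbert $C^*$-modules with inner products linear in the second variable, and inner products of Hilbert spaces are linear in the second variable. Let $A$ and $B$ be $C^*$-algebras, let $V$ and $W$ be full Hilbert modules over $A$ and $B$ respectively (that is, the linear spans of $\{\langle v,v'\rangle_A\}$ and $\{\langle w,w'\rangle_B\}$ are dense in $A$ and $B$), let $X$ be a Hilbert $B$-module, and let $A$ act on $X$ by adjointable operators through a $*$-homomorphism $\rho:A\to L(X)$; write $ax=\rho(a)x$. Let $H,K$ be complex Hilbert spaces. A *representation* of $W$ on $(H,K)$ associated with a representation ($*$-homomorphism) $\varphi:B\to B(H)$ is a map $\Phi:W\to B(H,K)$ with $\Phi(w)^*\Phi(w')=\varphi(\langle w,w'\rangle_B)$ for all $w,w'\in W$. It is *non-degenerate* if $\Phi(W)H$ spans a dense subspace of $K$ and $\Phi(W)^*K$ spans a dense subspace of $H$. For a Hilbert $B$-module $Y$, $Y\otimes_B H$ denotes the Hilbert space completion of the algebraic tensor product for $\langle y\otimes h,y'\otimes h'\rangle=\langle h,\varphi(\langle y,y'\rangle_B)h'\rangle$, and $V\otimes_A X$ denotes the interior tensor product, i.e. the Hilbert $B$-module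 obtained by completing the algebraic tensor product for $\langle v\otimes x,v'\otimes x'\rangle=\langle x,\langle v,v'\rangle_A x'\rangle_B$; put $V\otimes_A X\otimes_B H=(V\otimes_A X)\otimes_B H$. Let $\Phi:W\to B(H,K)$ be a non-degenerate representation of $W$, associated with $\varphi:B\to B(H)$. Then there are a representation $\mathrm{Ind}_X\varphi:A\to B(X\otimes_B H)$ with $$\mathrm{Ind}_X\varphi(a)(x\otimes h)=ax\otimes h\qquad(a\in A,\ x\in X,\ h\in H)$$ and a linear map $\mathrm{Ind}_X\Phi:V\to B(X\otimes_B H,\;V\otimes_A X\otimes_B H)$ with $$\mathrm{Ind}_X\Phi(v)(x\otimes h)=v\otimes x\otimes h\qquad(v\in V,\ x\in X,\ h\in H),$$ where for each $v$ the operator $\mathrm{Ind}_X\Phi(v)$ is the only bounded operator satisfying this formula, and $\mathrm{Ind}_X\Phi$ is a representation of $V$ associated with $\mathrm{Ind}_X\varphi$, that is, $\mathrm{Ind}_X\Phi(v)^*\,\mathrm{Ind}_X\Phi(v')=\mathrm{Ind}_X\varphi(\langle v,v'\rangle_A)$ for all $v,v'\in V$. If moreover $X$ is non-degenerate as an $A$-module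 (that is, $AX$ spans a dense subspace of $X$), then the representation $\mathrm{Ind}_X\Phi$ is non-degenerate. -/

import Mathlib

open scoped TensorProduct RightActions ComplexOrder
open UniformSpace

noncomputable section

/-! ### Hilbert modules -/

/-- A (right) semi-inner-product module over a C⋆-algebra `A`: a complex vector space with a
compatible right action `x <• a` of `A` and an `A`-valued positive semidefinite sesquilinear form
`inner A x y`, which is linear over `ℂ` and over `A` in the second variable and conjugate linear
in the first. -/
class SemiInnerModule (A E : Type*) [NonUnitalCStarAlgebra A] [PartialOrder A] [StarOrderedRing A]
    [AddCommGroup E] [Module ℂ E] extends SMul Aᵐᵒᵖ E, Inner A E where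
  add_rsmul (x y : E) (a : A) : (x + y) <• a = x <• a + y <• a
  rsmul_add (x : E) (a b : A) : x <• (a + b) = x <• a + x <• b
  rsmul_mul (x : E) (a b : A) : x <• (a * b) = (x <• a) <• b
  smul_rsmul (z : ℂ) (x : E) (a : A) : (z • x) <• a = z • (x <• a)
  rsmul_smul (z : ℂ) (x : E) (a : A) : x <• (z • a) = z • (x <• a)
  inner_add_right (x y y' : E) : inner x (y + y') = inner x y + inner x y'
  inner_smul_right (z : ℂ) (x y : E) : inner x (z • y) = z • inner x y
  inner_rsmul_right (x y : E) (a : A) : inner x (y <• a) = inner x y * a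
  star_inner (x y : E) : star (inner x y) = inner y x
  inner_self_nonneg (x : E) : 0 ≤ inner x x

/-- A (right) Hilbert C⋆-module over `A`: a right `A`-module with an `A`-valued inner product
which is a Banach space for the norm `‖x‖ = ‖⟨x, x⟩‖ ^ (1 / 2)`. (As the norm is definite, so is
the inner product.) -/
class HilbertModule (A V : Type*) [NonUnitalCStarAlgebra A] [PartialOrder A] [StarOrderedRing A]
    [NormedAddCommGroup V] [NormedSpace ℂ V] extends SemiInnerModule A V where
  norm_eq_sqrt_norm_inner_self (x : V) : ‖x‖ = √‖inner x x‖
  completeSpace : CompleteSpace V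

/-- A Hilbert `A`-module is full if the linear span of its inner products is dense in `A`. -/
def HilbertModule.IsFull (A V : Type*) [NonUnitalCStarAlgebra A] [PartialOrder A]
    [StarOrderedRing A] [NormedAddCommGroup V] [NormedSpace ℂ V] [HilbertModule A V] : Prop :=
  (Submodule.span ℂ {a : A | ∃ x y : V, inner A x y = a}).topologicalClosure = ⊤

namespace SemiInnerModule

section Basic

variable {A E : Type*} [NonUnitalCStarAlgebra A] [PartialOrder A] [StarOrderedRing A]
  [AddCommGroup E] [Module ℂ E] [SemiInnerModule A E]

theorem inner_add_left (x x' y : E) : inner A (x + x') y = inner A x y + inner A x' y := by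
  rw [← star_inner, inner_add_right, star_add, star_inner, star_inner]

theorem inner_smul_left (z : ℂ) (x y : E) : inner A (z • x) y = star z • inner A x y := by
  rw [← star_inner, inner_smul_right, star_smul, star_inner]

theorem inner_rsmul_left (x y : E) (a : A) : inner A (x <• a) y = star a * inner A x y := by
  rw [← star_inner, inner_rsmul_right, star_mul, star_inner]

variable (A E) in
/-- The inner product as a sesquilinear map. -/
def innerₗ : E →ₗ⋆[ℂ] E →ₗ[ℂ] A :=
  LinearMap.mk₂'ₛₗ (starRingEnd ℂ) (RingHom.id ℂ) (fun x y => inner A x y)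
    inner_add_left (fun z x y => inner_smul_left z x y) inner_add_right
    (fun z x y => inner_smul_right z x y)

theorem innerₗ_apply (x y : E) : innerₗ A E x y = inner A x y := rfl

variable (E) in
/-- Right multiplication by `a` as a linear map. -/
def rmulₗ (a : A) : E →ₗ[ℂ] E where
  toFun x := x <• a
  map_add' x y := add_rsmul x y a
  map_smul' z x := smul_rsmul z x a

theorem inner_sum_sum {ι : Type*} (s : Finset ι) (x : ι → E) (a : ι → A) :
    inner A (∑ i ∈ s, x i <• a i) (∑ j ∈ s, x j <• a j) =
      ∑ i ∈ s, ∑ j ∈ s, star (a i) * inner A (x i) (x j) * a j := by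
  rw [← innerₗ_apply, map_sum (innerₗ A E), LinearMap.sum_apply]
  refine Finset.sum_congr rfl fun i _ => ?_
  rw [map_sum]
  refine Finset.sum_congr rfl fun j _ => ?_
  rw [innerₗ_apply, inner_rsmul_right, inner_rsmul_left]

/-- A form of the decomposition of a self-adjoint element into positive and negative parts. -/
theorem exists_negPart {R : Type*} [NonUnitalCStarAlgebra R] [PartialOrder R] [StarOrderedRing R]
    (M : R) (hM : IsSelfAdjoint M) :
    ∃ Q S N : R, star Q * M * Q = -(star (S * Q) * (S * Q)) ∧ (S * Q = 0 → M = star N * N) := by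
  obtain ⟨S, hS⟩ := CStarAlgebra.nonneg_iff_eq_star_mul_self.mp (CFC.negPart_nonneg M)
  obtain ⟨N, hN⟩ := CStarAlgebra.nonneg_iff_eq_star_mul_self.mp (CFC.posPart_nonneg M)
  have hsa : star M⁻ = M⁻ := (CFC.negPart_nonneg M).isSelfAdjoint
  refine ⟨M⁻, S, N, ?_, fun h => ?_⟩
  · have h0 : M⁻ * M = -(M⁻ * M⁻) := by
      nth_rewrite 2 [← CFC.posPart_sub_negPart M hM]
      rw [mul_sub, CFC.negPart_mul_posPart, zero_sub]
    rw [star_mul, hsa, h0, neg_mul]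
    conv_lhs => rw [show M⁻ * M⁻ * M⁻ = M⁻ * (star S * S) * M⁻ by rw [← hS]]
    simp only [mul_assoc]
  · have h1 : star M⁻ * M⁻ = 0 := by
      rw [hsa]
      nth_rewrite 1 [hS]
      rw [mul_assoc, h, mul_zero]
    have h2 := CStarRing.star_mul_self_eq_zero_iff _ |>.mp h1
    conv_lhs => rw [← CFC.posPart_sub_negPart M hM, h2, sub_zero, hN]

/-- A Gram matrix is positive: it is of the form `N⋆ N`. -/
theorem exists_gram_eq {n : ℕ} (x : Fin n → E) :
    ∃ N : Fin n → Fin n → A, ∀ i j, inner A (x i) (x j) = ∑ k, star (N k i) * N k j := by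
  let M : CStarMatrix (Fin n) (Fin n) A := CStarMatrix.ofMatrix fun i j => inner A (x i) (x j)
  have hM : IsSelfAdjoint M := by
    ext i j
    exact star_inner _ _
  obtain ⟨Q, S, N, hQ, hN⟩ := exists_negPart M hM
  have h2 : S * Q = 0 := by
    ext l k
    have h3 := inner_self_nonneg (A := A) (∑ i, x i <• Q i k)
    rw [inner_sum_sum, Finset.sum_comm] at h3
    have h3' : 0 ≤ (star Q * M * Q) k k := by
      convert h3 using 1
      simp only [CStarMatrix.mul_apply, Finset.sum_mul]
      rfl
    have h4 : (star (S * Q) * (S * Q)) k k = ∑ l, star ((S * Q) l k) * (S * Q) l k := by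
      rw [CStarMatrix.mul_apply]; rfl
    have h5 : ∑ l, star ((S * Q) l k) * (S * Q) l k ≤ 0 := by
      rw [hQ] at h3'
      rw [← h4]; exact neg_nonneg.mp h3'
    have h6 := (Finset.sum_eq_zero_iff_of_nonneg
      (fun l _ => star_mul_self_nonneg ((S * Q) l k))).mp
      (le_antisymm h5 (Finset.sum_nonneg fun l _ => star_mul_self_nonneg _)) l (Finset.mem_univ _)
    exact CStarRing.star_mul_self_eq_zero_iff _ |>.mp h6
  refine ⟨fun k i => N k i, fun i j => ?_⟩
  have := congrFun (congrFun (hN h2) i) j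
  rw [CStarMatrix.mul_apply] at this
  exact this

/-- The Cauchy-Schwarz inequality. -/
theorem norm_inner_sq_le (x y : E) :
    ‖inner A x y‖ ^ 2 ≤ ‖inner A x x‖ * ‖inner A y y‖ := by
  set c := inner A x y with hc
  have hcy : inner A y x = star c := (star_inner x y).symm
  have key : ∀ s : ℝ, 0 ≤ s → 0 ≤ 2 * s - s ^ 2 * ‖inner A x x‖ →
      (2 * s - s ^ 2 * ‖inner A x x‖) * ‖c‖ ^ 2 ≤ ‖inner A y y‖ := by
    intro s hs hpos
    have h0 := inner_self_nonneg (A := A) ((s : ℂ) • (x <• c) + (-1 : ℂ) • y)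
    have h1 : inner A ((s : ℂ) • (x <• c) + (-1 : ℂ) • y) ((s : ℂ) • (x <• c) + (-1 : ℂ) • y) =
        (s ^ 2) • (star c * inner A x x * c) - (2 * s) • (star c * c) + inner A y y := by
      simp only [inner_add_left, inner_add_right, inner_smul_left, inner_smul_right,
        inner_rsmul_left, inner_rsmul_right, hcy, ← hc]
      simp only [Complex.star_def, Complex.conj_ofReal, Complex.coe_smul, map_neg, map_one,
        neg_smul, one_smul, smul_neg, neg_neg, smul_add, add_mul, smul_mul_assoc, neg_mul,
        mul_assoc]
      module
    have h2 : star c * inner A x x * c ≤ ‖inner A x x‖ • (star c * c) :=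
      CStarAlgebra.star_left_conjugate_le_norm_smul (hb := star_inner x x)
    have h3 : (2 * s - s ^ 2 * ‖inner A x x‖) • (star c * c) ≤ inner A y y := by
      have h4 := smul_le_smul_of_nonneg_left h2 (sq_nonneg s)
      rw [h1] at h0
      rw [sub_smul, mul_smul (s ^ 2)]
      rw [← sub_nonneg]
      refine (add_nonneg h0 (sub_nonneg.mpr h4)).trans_eq ?_
      abel
    have h5 := CStarAlgebra.norm_le_norm_of_nonneg_of_le
      (smul_nonneg hpos (star_mul_self_nonneg c)) h3
    rwa [norm_smul, CStarRing.norm_star_mul_self, Real.norm_of_nonneg hpos, ← sq] at h5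
  rcases (norm_nonneg (inner A x x)).eq_or_lt' with h | h
  · rw [h, zero_mul]
    by_contra! hlt
    have h1 := key ((‖inner A y y‖ + 1) / ‖c‖ ^ 2) (by positivity) (by rw [h, mul_zero, sub_zero]; positivity)
    rw [h, mul_zero, sub_zero, mul_assoc, div_mul_cancel₀ _ hlt.ne'] at h1
    have := norm_nonneg (inner A y y)
    linarith
  · have h1 := key (‖inner A x x‖)⁻¹ (by positivity)
      (by field_simp; norm_num)
    field_simp at h1
    nlinarith

end Basic

section Seminorm

variable (A E : Type*) [NonUnitalCStarAlgebra A] [PartialOrder A] [StarOrderedRing A]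
  [AddCommGroup E] [Module ℂ E] [SemiInnerModule A E]

/-- The seminorm `x ↦ ‖⟨x, x⟩‖ ^ (1 / 2)`. -/
abbrev norm : Norm E := ⟨fun x => √‖inner A x x‖⟩

theorem seminormedSpaceCore : letI := norm A E; SeminormedSpace.Core ℂ E := by
  let := norm A E
  refine ⟨fun x => Real.sqrt_nonneg _, fun c x => ?_, fun x y => ?_⟩
  · change √‖inner A (c • x) (c • x)‖ = ‖c‖ * √‖inner A x x‖
    rw [inner_smul_left, inner_smul_right, norm_smul, norm_smul, norm_star, ← mul_assoc,
      Real.sqrt_mul (by positivity), Real.sqrt_mul_self (by positivity)]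
  · change √‖inner A (x + y) (x + y)‖ ≤ √‖inner A x x‖ + √‖inner A y y‖
    have hxy : ‖inner A x y‖ ≤ √‖inner A x x‖ * √‖inner A y y‖ := by
      rw [← Real.sqrt_mul (norm_nonneg _)]
      exact Real.le_sqrt_of_sq_le (norm_inner_sq_le x y)
    have hyx : ‖inner A y x‖ ≤ √‖inner A x x‖ * √‖inner A y y‖ := by
      rwa [← star_inner, norm_star]
    rw [Real.sqrt_le_left (by positivity), inner_add_left, inner_add_right, inner_add_right]
    have h1 := norm_add_le (inner A x x + inner A x y) (inner A y x + inner A y y)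
    have h2 := norm_add_le (inner A x x) (inner A x y)
    have h3 := norm_add_le (inner A y x) (inner A y y)
    have h4 := Real.sq_sqrt (norm_nonneg (inner A x x))
    have h5 := Real.sq_sqrt (norm_nonneg (inner A y y))
    nlinarith

/-- The seminormed group structure of a semi-inner-product module. -/
abbrev seminormedAddCommGroup : SeminormedAddCommGroup E :=
  letI := norm A E
  SeminormedAddCommGroup.ofCore (seminormedSpaceCore A E)

/-- The seminormed space structure of a semi-inner-product module. -/
abbrev normedSpace :
    letI := seminormedAddCommGroup A E
    NormedSpace ℂ E :=
  letI := norm A E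
  letI := seminormedAddCommGroup A E
  { norm_smul_le := fun c x => ((seminormedSpaceCore A E).norm_smul c x).le }

end Seminorm

section Completion

variable {A E : Type*} [NonUnitalCStarAlgebra A] [PartialOrder A] [StarOrderedRing A]
  [SeminormedAddCommGroup E] [NormedSpace ℂ E] [SemiInnerModule A E]

theorem norm_inner_le (hE : ∀ x : E, ‖x‖ = √‖inner A x x‖) (x y : E) :
    ‖inner A x y‖ ≤ ‖x‖ * ‖y‖ := by
  rw [hE, hE, ← Real.sqrt_mul (norm_nonneg _)]
  exact Real.le_sqrt_of_sq_le (norm_inner_sq_le x y)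

theorem norm_rsmul_le (hE : ∀ x : E, ‖x‖ = √‖inner A x x‖) (x : E) (a : A) :
    ‖x <• a‖ ≤ ‖a‖ * ‖x‖ := by
  rw [hE, hE, Real.sqrt_le_left (by positivity), inner_rsmul_left, inner_rsmul_right, mul_pow,
    Real.sq_sqrt (norm_nonneg _)]
  have h1 := norm_mul_le (star a) (inner A x x * a)
  have h2 := norm_mul_le (inner A x x) a
  rw [norm_star] at h1
  nlinarith [norm_nonneg a]

/-- Right multiplication by `a` as a continuous linear map. -/
def rmulL (hE : ∀ x : E, ‖x‖ = √‖inner A x x‖) (a : A) : E →L[ℂ] E :=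
  (rmulₗ E a).mkContinuous ‖a‖ fun x => norm_rsmul_le hE x a

theorem continuous_inner (hE : ∀ x : E, ‖x‖ = √‖inner A x x‖) :
    Continuous (Function.uncurry (inner A : E → E → A)) :=
  let f : E →L⋆[ℂ] E →L[ℂ] A := (innerₗ A E).mkContinuous₂ 1 fun x y => by
    rw [one_mul]; exact norm_inner_le hE x y
  (f.continuous.comp continuous_fst).clm_apply continuous_snd

theorem completion_inner_coe (hE : ∀ x : E, ‖x‖ = √‖inner A x x‖) (x y : E) :
    inner A (x : Completion E) (y : Completion E) = inner A x y :=
  (Completion.isDenseInducing_coe.prodMap Completion.isDenseInducing_coe).extend_eq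
    (continuous_inner hE) (x, y)

theorem completion_continuous_inner (hE : ∀ x : E, ‖x‖ = √‖inner A x x‖) :
    Continuous (Function.uncurry (inner A : Completion E → Completion E → A)) := by
  let inner' : E →+ E →+ A :=
    { toFun := fun x => (innerₗ A E x).toAddMonoidHom
      map_zero' := by ext y; simp
      map_add' := fun x y => by ext z; simp }
  have : Continuous fun p : E × E => inner' p.1 p.2 := continuous_inner hE
  rw [Completion.toInner, inner, Function.uncurry_curry _]
  change Continuous (((Completion.isDenseInducing_toCompl E).prodMap
    (Completion.isDenseInducing_toCompl E)).extend fun p : E × E => inner' p.1 p.2)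
  exact (Completion.isDenseInducing_toCompl E).extend_Z_bilin
    (Completion.isDenseInducing_toCompl E) this

theorem completion_inner_cont {T : Type*} [TopologicalSpace T]
    (hE : ∀ x : E, ‖x‖ = √‖inner A x x‖) {f g : T → Completion E} (hf : Continuous f)
    (hg : Continuous g) : Continuous fun t => inner A (f t) (g t) :=
  (completion_continuous_inner hE).comp (hf.prodMk hg)

theorem rmulL_completion_add (hE : ∀ x : E, ‖x‖ = √‖inner A x x‖) (x : Completion E) (a b : A) :
    (rmulL hE (a + b)).completion x = (rmulL hE a).completion x + (rmulL hE b).completion x := by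
  refine Completion.induction_on x (isClosed_eq (by fun_prop) (by fun_prop)) fun x => ?_
  simp only [ContinuousLinearMap.completion_apply_coe, ← Completion.coe_add]
  exact congrArg _ (rsmul_add x a b)

theorem rmulL_completion_mul (hE : ∀ x : E, ‖x‖ = √‖inner A x x‖) (x : Completion E) (a b : A) :
    (rmulL hE (a * b)).completion x = (rmulL hE b).completion ((rmulL hE a).completion x) := by
  refine Completion.induction_on x (isClosed_eq (by fun_prop) (by fun_prop)) fun x => ?_
  simp only [ContinuousLinearMap.completion_apply_coe]
  exact congrArg _ (rsmul_mul x a b)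

theorem rmulL_completion_smul (hE : ∀ x : E, ‖x‖ = √‖inner A x x‖) (z : ℂ) (x : Completion E)
    (a : A) : (rmulL hE (z • a)).completion x = z • (rmulL hE a).completion x := by
  refine Completion.induction_on x (isClosed_eq (rmulL hE (z • a)).completion.continuous
    ((rmulL hE a).completion.continuous.const_smul z)) fun x => ?_
  simp only [ContinuousLinearMap.completion_apply_coe, ← Completion.coe_smul]
  exact congrArg _ (rsmul_smul z x a)

theorem completion_inner_add (hE : ∀ x : E, ‖x‖ = √‖inner A x x‖) (x y y' : Completion E) :
    inner A x (y + y') = inner A x y + inner A x y' := by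
  have hcl : IsClosed {p : Completion E × Completion E × Completion E |
      inner A p.1 (p.2.1 + p.2.2) = inner A p.1 p.2.1 + inner A p.1 p.2.2} := isClosed_eq
    (completion_inner_cont hE continuous_fst (continuous_snd.fst.add continuous_snd.snd))
    ((completion_inner_cont hE continuous_fst continuous_snd.fst).add
      (completion_inner_cont hE continuous_fst continuous_snd.snd))
  refine Completion.induction_on₃ x y y' hcl fun x y y' => ?_
  rw [← Completion.coe_add, completion_inner_coe hE, completion_inner_coe hE,
    completion_inner_coe hE, inner_add_right]

theorem completion_inner_smul (hE : ∀ x : E, ‖x‖ = √‖inner A x x‖) (z : ℂ) (x y : Completion E) :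
    inner A x (z • y) = z • inner A x y := by
  refine Completion.induction_on₂ x y (isClosed_eq
    (completion_inner_cont hE continuous_fst (continuous_snd.const_smul z))
    ((completion_inner_cont hE continuous_fst continuous_snd).const_smul z)) fun x y => ?_
  simp only [← Completion.coe_smul, completion_inner_coe hE, inner_smul_right]

theorem completion_inner_rmulL (hE : ∀ x : E, ‖x‖ = √‖inner A x x‖) (x y : Completion E) (a : A) :
    inner A x ((rmulL hE a).completion y) = inner A x y * a := by
  refine Completion.induction_on₂ x y (isClosed_eq
    (completion_inner_cont hE continuous_fst
      ((rmulL hE a).completion.continuous.comp continuous_snd))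
    ((completion_inner_cont hE continuous_fst continuous_snd).mul continuous_const)) fun x y => ?_
  simp only [ContinuousLinearMap.completion_apply_coe, completion_inner_coe hE]
  exact inner_rsmul_right x y a

theorem completion_star_inner (hE : ∀ x : E, ‖x‖ = √‖inner A x x‖) (x y : Completion E) :
    star (inner A x y) = inner A y x := by
  refine Completion.induction_on₂ x y (isClosed_eq
    (completion_inner_cont hE continuous_fst continuous_snd).star
    (completion_inner_cont hE continuous_snd continuous_fst)) fun x y => ?_
  simp only [completion_inner_coe hE, star_inner]

theorem completion_inner_self_nonneg (hE : ∀ x : E, ‖x‖ = √‖inner A x x‖) (x : Completion E) :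
    0 ≤ inner A x x := by
  refine Completion.induction_on x ((CStarAlgebra.isClosed_nonneg (A := A)).preimage
    (completion_inner_cont hE continuous_id continuous_id)) fun x => ?_
  rw [completion_inner_coe hE]
  exact inner_self_nonneg x

theorem completion_norm_eq (hE : ∀ x : E, ‖x‖ = √‖inner A x x‖) (x : Completion E) :
    ‖x‖ = √‖inner A x x‖ := by
  refine Completion.induction_on x (isClosed_eq continuous_norm
    (completion_inner_cont hE continuous_id continuous_id).norm.sqrt) fun x => ?_
  rw [completion_inner_coe hE, Completion.norm_coe, hE]

/-- The completion of a semi-inner-product module is a Hilbert module: its inner product and its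
right action are the continuous extensions of those of the module. -/
abbrev completionHilbertModule (hE : ∀ x : E, ‖x‖ = √‖inner A x x‖) :
    HilbertModule A (Completion E) where
  smul a x := (rmulL hE a.unop).completion x
  inner := inner A
  add_rsmul x y a := map_add (rmulL hE a).completion x y
  rsmul_add := rmulL_completion_add hE
  rsmul_mul := rmulL_completion_mul hE
  smul_rsmul z x a := map_smul (rmulL hE a).completion z x
  rsmul_smul := rmulL_completion_smul hE
  inner_add_right := completion_inner_add hE
  inner_smul_right := completion_inner_smul hE
  inner_rsmul_right := completion_inner_rmulL hE
  star_inner := completion_star_inner hE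
  inner_self_nonneg := completion_inner_self_nonneg hE
  norm_eq_sqrt_norm_inner_self := completion_norm_eq hE
  completeSpace := inferInstance

end Completion

end SemiInnerModule

/-! ### Actions by adjointable operators and the interior tensor product -/

/-- An action of `A` by adjointable operators on the Hilbert `B`-module `X`, that is, a
⋆-homomorphism from `A` to the C⋆-algebra of adjointable operators on `X`: a homomorphism `ρ`
from `A` to the algebra of bounded operators on `X` such that `ρ (star a)` is the adjoint
of `ρ a` with respect to the `B`-valued inner product. -/
structure AdjointableAction (A B X : Type*) [NonUnitalCStarAlgebra A] [NonUnitalCStarAlgebra B]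
    [PartialOrder B] [StarOrderedRing B] [NormedAddCommGroup X] [NormedSpace ℂ X]
    [HilbertModule B X] extends A →ₙₐ[ℂ] (X →L[ℂ] X) where
  inner_map_left (a : A) (x y : X) : inner B (toFun a x) y = inner B x (toFun (star a) y)

namespace AdjointableAction

variable {A B X : Type*} [NonUnitalCStarAlgebra A] [NonUnitalCStarAlgebra B]
  [PartialOrder B] [StarOrderedRing B] [NormedAddCommGroup X] [NormedSpace ℂ X]
  [HilbertModule B X]

instance : CoeFun (AdjointableAction A B X) (fun _ => A → X →L[ℂ] X) :=
  ⟨fun ρ => ρ.toNonUnitalAlgHom⟩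

theorem inner_left (ρ : AdjointableAction A B X) (a : A) (x y : X) :
    inner B (ρ a x) y = inner B x (ρ (star a) y) :=
  ρ.inner_map_left a x y

/-- The action of `A` on `X` is non-degenerate if `A X` spans a dense subspace of `X`. -/
def IsNondegenerate (ρ : AdjointableAction A B X) : Prop :=
  (Submodule.span ℂ {y : X | ∃ (a : A) (x : X), ρ a x = y}).topologicalClosure = ⊤

end AdjointableAction

section Interior

variable {A B X : Type*} [NonUnitalCStarAlgebra A] [PartialOrder A] [StarOrderedRing A]
  [NonUnitalCStarAlgebra B] [PartialOrder B] [StarOrderedRing B]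
  (V : Type*) [NormedAddCommGroup V] [NormedSpace ℂ V] [HilbertModule A V]
  [NormedAddCommGroup X] [NormedSpace ℂ X] [HilbertModule B X]
  (ρ : AdjointableAction A B X)

set_option linter.unusedVariables false in
/-- The algebraic tensor product of `V` and `X` over `ℂ`, as the underlying space of the
semi-inner-product `B`-module whose completion is the interior tensor product of `V` and `X`. -/
@[nolint unusedArguments]
def PreInteriorTensor (ρ : AdjointableAction A B X) : Type _ := V ⊗[ℂ] X

namespace PreInteriorTensor

instance : AddCommGroup (PreInteriorTensor V ρ) := inferInstanceAs (AddCommGroup (V ⊗[ℂ] X))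
instance : Module ℂ (PreInteriorTensor V ρ) := inferInstanceAs (Module ℂ (V ⊗[ℂ] X))

/-- The `B`-valued sesquilinear form `⟨v ⊗ x, v' ⊗ x'⟩ = ⟨x, ρ(⟨v, v'⟩) x'⟩`. -/
def form : V ⊗[ℂ] X →ₗ⋆[ℂ] V ⊗[ℂ] X →ₗ[ℂ] B :=
  TensorProduct.lift <| LinearMap.mk₂'ₛₗ (starRingEnd ℂ) (starRingEnd ℂ)
    (fun v x => TensorProduct.lift <| LinearMap.mk₂ ℂ
      (fun v' x' => (inner B x (ρ (inner A v v') x') : B))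
      (fun v' v'' x' => by
        simp only [SemiInnerModule.inner_add_right, map_add, add_apply])
      (fun z v' x' => by
        simp only [SemiInnerModule.inner_smul_right, map_smul, smul_apply])
      (fun v' x' x'' => by simp only [SemiInnerModule.inner_add_right, map_add])
      (fun z v' x' => by simp only [SemiInnerModule.inner_smul_right, map_smul]))
    (fun v w x => TensorProduct.ext' fun v' x' => by
      simp [SemiInnerModule.inner_add_left, SemiInnerModule.inner_add_right])
    (fun z v x => TensorProduct.ext' fun v' x' => by
      simp [SemiInnerModule.inner_smul_left, SemiInnerModule.inner_smul_right])
    (fun v x y => TensorProduct.ext' fun v' x' => by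
      simp [SemiInnerModule.inner_add_left])
    (fun z v x => TensorProduct.ext' fun v' x' => by
      simp [SemiInnerModule.inner_smul_left])

theorem form_tmul (v v' : V) (x x' : X) :
    form V ρ (v ⊗ₜ x) (v' ⊗ₜ x') = inner B x (ρ (inner A v v') x') := rfl

theorem star_form (s t : V ⊗[ℂ] X) : star (form V ρ s t) = form V ρ t s := by
  induction s with
  | zero => simp
  | add s s' hs hs' => simp [hs, hs']
  | tmul v x =>
    induction t with
    | zero => simp
    | add t t' ht ht' => simp [ht, ht']
    | tmul v' x' =>
      rw [form_tmul, form_tmul, SemiInnerModule.star_inner, ρ.inner_left,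
        SemiInnerModule.star_inner]

theorem form_rmul (s t : V ⊗[ℂ] X) (b : B) :
    form V ρ s ((SemiInnerModule.rmulₗ X b).lTensor V t) = form V ρ s t * b := by
  induction s with
  | zero => simp
  | add s s' hs hs' => simp [hs, hs', add_mul]
  | tmul v x =>
    induction t with
    | zero => simp
    | add t t' ht ht' => simp [ht, ht', add_mul]
    | tmul v' x' =>
      rw [LinearMap.lTensor_tmul, form_tmul, form_tmul, ← star_star (inner A v v'),
        ← ρ.inner_left, ← ρ.inner_left]
      exact SemiInnerModule.inner_rsmul_right _ _ _

theorem form_self_nonneg (s : V ⊗[ℂ] X) : 0 ≤ form V ρ s s := by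
  obtain ⟨n, v, x, rfl⟩ := TensorProduct.exists_sum_tmul_eq s
  obtain ⟨N, hN⟩ := SemiInnerModule.exists_gram_eq (A := A) v
  have h : form V ρ (∑ i, v i ⊗ₜ x i) (∑ i, v i ⊗ₜ x i) =
      ∑ k, inner B (∑ i, ρ (N k i) (x i)) (∑ j, ρ (N k j) (x j)) := by
    have hl : form V ρ (∑ i, v i ⊗ₜ x i) (∑ i, v i ⊗ₜ x i) =
        ∑ i, ∑ j, form V ρ (v i ⊗ₜ x i) (v j ⊗ₜ x j) := by
      rw [map_sum (form V ρ), LinearMap.sum_apply]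
      exact Finset.sum_congr rfl fun i _ => map_sum _ _ _
    have hr : ∀ k, inner B (∑ i, ρ (N k i) (x i)) (∑ j, ρ (N k j) (x j)) =
        ∑ i, ∑ j, inner B (ρ (N k i) (x i)) (ρ (N k j) (x j)) := fun k => by
      rw [← SemiInnerModule.innerₗ_apply, map_sum (SemiInnerModule.innerₗ B X),
        LinearMap.sum_apply]
      exact Finset.sum_congr rfl fun i _ => map_sum _ _ _
    simp only [hl, hr]
    have hc : ∀ f : Fin n → Fin n → Fin n → B,
        ∑ k, ∑ i, ∑ j, f k i j = ∑ i, ∑ j, ∑ k, f k i j := fun f => by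
      rw [Finset.sum_comm]
      exact Finset.sum_congr rfl fun i _ => Finset.sum_comm
    rw [hc]
    refine Finset.sum_congr rfl fun i _ => Finset.sum_congr rfl fun j _ => ?_
    rw [form_tmul, hN, map_sum, sum_apply,
      ← SemiInnerModule.innerₗ_apply, map_sum]
    refine Finset.sum_congr rfl fun k _ => ?_
    rw [SemiInnerModule.innerₗ_apply, map_mul, ρ.inner_left]
    rfl
  rw [h]
  exact Finset.sum_nonneg fun k _ => SemiInnerModule.inner_self_nonneg _

theorem rmul_add (t : V ⊗[ℂ] X) (a b : B) : (SemiInnerModule.rmulₗ X (a + b)).lTensor V t =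
    (SemiInnerModule.rmulₗ X a).lTensor V t + (SemiInnerModule.rmulₗ X b).lTensor V t := by
  have : SemiInnerModule.rmulₗ X (a + b) = SemiInnerModule.rmulₗ X a + SemiInnerModule.rmulₗ X b :=
    LinearMap.ext fun x => SemiInnerModule.rsmul_add x a b
  rw [this, LinearMap.lTensor_add, LinearMap.add_apply]

theorem rmul_mul (t : V ⊗[ℂ] X) (a b : B) : (SemiInnerModule.rmulₗ X (a * b)).lTensor V t =
    (SemiInnerModule.rmulₗ X b).lTensor V ((SemiInnerModule.rmulₗ X a).lTensor V t) := by
  have : SemiInnerModule.rmulₗ X (a * b) =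
      SemiInnerModule.rmulₗ X b ∘ₗ SemiInnerModule.rmulₗ X a :=
    LinearMap.ext fun x => SemiInnerModule.rsmul_mul x a b
  rw [this, LinearMap.lTensor_comp, LinearMap.comp_apply]

theorem rmul_smul (z : ℂ) (t : V ⊗[ℂ] X) (b : B) :
    (SemiInnerModule.rmulₗ X (z • b)).lTensor V t =
      z • (SemiInnerModule.rmulₗ X b).lTensor V t := by
  have : SemiInnerModule.rmulₗ X (z • b) = z • SemiInnerModule.rmulₗ X b :=
    LinearMap.ext fun x => SemiInnerModule.rsmul_smul z x b
  rw [this, LinearMap.lTensor_smul, LinearMap.smul_apply]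

instance : SemiInnerModule B (PreInteriorTensor V ρ) where
  smul b t := (SemiInnerModule.rmulₗ X b.unop).lTensor V t
  inner s t := form V ρ s t
  add_rsmul s t b := map_add ((SemiInnerModule.rmulₗ X b).lTensor V) s t
  rsmul_add := rmul_add V
  rsmul_mul := rmul_mul V
  smul_rsmul z t b := map_smul ((SemiInnerModule.rmulₗ X b).lTensor V) z t
  rsmul_smul := rmul_smul V
  inner_add_right s := map_add (form V ρ s)
  inner_smul_right z s t := map_smul (form V ρ s) z t
  inner_rsmul_right := form_rmul V ρ
  star_inner := star_form V ρ
  inner_self_nonneg := form_self_nonneg V ρ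

instance : SeminormedAddCommGroup (PreInteriorTensor V ρ) :=
  SemiInnerModule.seminormedAddCommGroup B _
instance : NormedSpace ℂ (PreInteriorTensor V ρ) := SemiInnerModule.normedSpace B _

end PreInteriorTensor

/-- The interior tensor product `V ⊗_A X` of a Hilbert `A`-module `V` and a Hilbert `B`-module `X`
on which `A` acts by adjointable operators: the (Hausdorff) completion of the algebraic tensor
product for `⟨v ⊗ x, v' ⊗ x'⟩ = ⟨x, ρ(⟨v, v'⟩) x'⟩`. In it `v a ⊗ x = v ⊗ ρ(a) x`, because the
difference of these two tensors has norm zero. -/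
abbrev InteriorTensor : Type _ := Completion (PreInteriorTensor V ρ)

instance : HilbertModule B (InteriorTensor V ρ) :=
  SemiInnerModule.completionHilbertModule fun _ => rfl

variable {V} in
/-- The elementary tensor `v ⊗ x` in `V ⊗_A X`. -/
def InteriorTensor.tmul (v : V) (x : X) : InteriorTensor V ρ :=
  Completion.coe' (α := PreInteriorTensor V ρ) (v ⊗ₜ[ℂ] x)

end Interior

/-! ### The Hilbert space of Rieffel induction -/

section HilbertTensor

variable {B H : Type*} [NonUnitalCStarAlgebra B] [PartialOrder B] [StarOrderedRing B]
  (X : Type*) [NormedAddCommGroup X] [NormedSpace ℂ X] [HilbertModule B X]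
  [NormedAddCommGroup H] [InnerProductSpace ℂ H] [CompleteSpace H]
  (φ : B →⋆ₙₐ[ℂ] (H →L[ℂ] H))

set_option linter.unusedVariables false in
/-- The algebraic tensor product of `X` and `H` over `ℂ`, as the underlying space of the
semi-inner-product space whose completion is `X ⊗_B H`. -/
@[nolint unusedArguments]
def PreHilbertTensor (φ : B →⋆ₙₐ[ℂ] (H →L[ℂ] H)) : Type _ := X ⊗[ℂ] H

namespace PreHilbertTensor

instance : AddCommGroup (PreHilbertTensor X φ) := inferInstanceAs (AddCommGroup (X ⊗[ℂ] H))
instance : Module ℂ (PreHilbertTensor X φ) := inferInstanceAs (Module ℂ (X ⊗[ℂ] H))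

/-- The sesquilinear form `⟨x ⊗ h, x' ⊗ h'⟩ = ⟨h, φ(⟨x, x'⟩) h'⟩`. -/
def form : X ⊗[ℂ] H →ₗ⋆[ℂ] X ⊗[ℂ] H →ₗ[ℂ] ℂ :=
  TensorProduct.lift <| LinearMap.mk₂'ₛₗ (starRingEnd ℂ) (starRingEnd ℂ)
    (fun x h => TensorProduct.lift <| LinearMap.mk₂ ℂ
      (fun x' h' => (inner ℂ h (φ (inner B x x') h') : ℂ))
      (fun x' x'' h' => by
        simp only [SemiInnerModule.inner_add_right, map_add, add_apply,
          inner_add_right])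
      (fun z x' h' => by
        simp only [SemiInnerModule.inner_smul_right, map_smul, smul_apply,
          inner_smul_right, smul_eq_mul])
      (fun x' h' h'' => by simp only [inner_add_right, map_add])
      (fun z x' h' => by simp only [inner_smul_right, map_smul, smul_eq_mul]))
    (fun x y h => TensorProduct.ext' fun x' h' => by
      simp [SemiInnerModule.inner_add_left])
    (fun z x h => TensorProduct.ext' fun x' h' => by
      simp [SemiInnerModule.inner_smul_left])
    (fun x h k => TensorProduct.ext' fun x' h' => by simp)
    (fun z x h => TensorProduct.ext' fun x' h' => by simp [mul_comm])

theorem form_tmul (x x' : X) (h h' : H) :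
    form X φ (x ⊗ₜ h) (x' ⊗ₜ h') = inner ℂ h (φ (inner B x x') h') := rfl

theorem conj_form (s t : X ⊗[ℂ] H) : starRingEnd ℂ (form X φ t s) = form X φ s t := by
  induction s with
  | zero => simp
  | add s s' hs hs' => simp [hs, hs']
  | tmul x h =>
    induction t with
    | zero => simp
    | add t t' ht ht' => simp [ht, ht']
    | tmul x' h' =>
      rw [form_tmul, form_tmul, inner_conj_symm, ← SemiInnerModule.star_inner x x', map_star,
        ContinuousLinearMap.star_eq_adjoint, ContinuousLinearMap.adjoint_inner_left]

theorem form_self_nonneg (s : X ⊗[ℂ] H) : 0 ≤ (form X φ s s).re := by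
  obtain ⟨n, x, h, rfl⟩ := TensorProduct.exists_sum_tmul_eq s
  obtain ⟨N, hN⟩ := SemiInnerModule.exists_gram_eq (A := B) x
  have key : form X φ (∑ i, x i ⊗ₜ h i) (∑ i, x i ⊗ₜ h i) =
      ∑ k, inner ℂ (∑ i, φ (N k i) (h i)) (∑ j, φ (N k j) (h j)) := by
    have hl : form X φ (∑ i, x i ⊗ₜ h i) (∑ i, x i ⊗ₜ h i) =
        ∑ i, ∑ j, form X φ (x i ⊗ₜ h i) (x j ⊗ₜ h j) := by
      rw [map_sum (form X φ), LinearMap.sum_apply]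
      exact Finset.sum_congr rfl fun i _ => map_sum _ _ _
    have hc : ∀ f : Fin n → Fin n → Fin n → ℂ,
        ∑ k, ∑ i, ∑ j, f k i j = ∑ i, ∑ j, ∑ k, f k i j := fun f => by
      rw [Finset.sum_comm]
      exact Finset.sum_congr rfl fun i _ => Finset.sum_comm
    have hr : ∀ k, inner ℂ (∑ i, φ (N k i) (h i)) (∑ j, φ (N k j) (h j)) =
        ∑ i, ∑ j, inner ℂ (φ (N k i) (h i)) (φ (N k j) (h j)) := fun k => by
      rw [sum_inner]
      exact Finset.sum_congr rfl fun i _ => inner_sum _ _ _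
    simp only [hl, hr]
    rw [hc]
    refine Finset.sum_congr rfl fun i _ => Finset.sum_congr rfl fun j _ => ?_
    rw [form_tmul, hN, map_sum, sum_apply, inner_sum]
    refine Finset.sum_congr rfl fun k _ => ?_
    have hk : φ (star (N k i) * N k j) = ContinuousLinearMap.adjoint (φ (N k i)) * φ (N k j) := by
      rw [map_mul φ, ← ContinuousLinearMap.star_eq_adjoint, ← map_star φ]
    rw [hk, mul_apply_eq_comp, ContinuousLinearMap.adjoint_inner_right]
  rw [key, Complex.re_sum]
  exact Finset.sum_nonneg fun k _ => inner_self_nonneg (𝕜 := ℂ)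

/-- The semi-inner product of `PreHilbertTensor`. -/
abbrev core : PreInnerProductSpace.Core ℂ (PreHilbertTensor X φ) where
  inner s t := form X φ s t
  conj_inner_symm := conj_form X φ
  re_inner_nonneg := form_self_nonneg X φ
  add_left s s' t := LinearMap.map_add₂ (form X φ) s s' t
  smul_left s t z := LinearMap.map_smulₛₗ₂ (form X φ) z s t

instance : SeminormedAddCommGroup (PreHilbertTensor X φ) :=
  InnerProductSpace.Core.toSeminormedAddCommGroup (c := core X φ)
instance : InnerProductSpace ℂ (PreHilbertTensor X φ) := InnerProductSpace.ofCore (core X φ)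

end PreHilbertTensor

/-- The Hilbert space `X ⊗_B H` of a Hilbert `B`-module `X` and a representation `φ` of `B` on `H`:
the (Hausdorff) completion of the algebraic tensor product for
`⟨x ⊗ h, x' ⊗ h'⟩ = ⟨h, φ(⟨x, x'⟩) h'⟩` (inner products are linear in the second variable). -/
abbrev HilbertTensor : Type _ := Completion (PreHilbertTensor X φ)

variable {X} in
/-- The elementary tensor `x ⊗ h` in `X ⊗_B H`. -/
def HilbertTensor.tmul (x : X) (h : H) : HilbertTensor X φ :=
  Completion.coe' (α := PreHilbertTensor X φ) (x ⊗ₜ[ℂ] h)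

end HilbertTensor

/-! ### Representations of Hilbert modules -/

section Representation

variable {A V H K : Type*} [NonUnitalCStarAlgebra A] [PartialOrder A] [StarOrderedRing A]
  [NormedAddCommGroup V] [NormedSpace ℂ V] [HilbertModule A V]
  [NormedAddCommGroup H] [InnerProductSpace ℂ H] [CompleteSpace H]
  [NormedAddCommGroup K] [InnerProductSpace ℂ K] [CompleteSpace K]

/-- The map `Φ : V → B(H, K)` is a representation of the Hilbert `A`-module `V`, associated with
the representation `φ` of `A` on `H`, if `⟨Φ v, Φ w⟩ = (Φ v)⋆ (Φ w) = φ(⟨v, w⟩)`. -/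
def IsModuleRepresentation (φ : A →⋆ₙₐ[ℂ] (H →L[ℂ] H)) (Φ : V → H →L[ℂ] K) : Prop :=
  ∀ v w : V, ContinuousLinearMap.adjoint (Φ v) ∘L Φ w = φ (inner A v w)

end Representation

/-- A representation `Φ : V → B(H, K)` is non-degenerate if `Φ(V) H` spans a dense subspace of `K`
and `Φ(V)⋆ K` spans a dense subspace of `H`. -/
structure IsNondegenerateRepresentation {V H K : Type*}
    [NormedAddCommGroup H] [InnerProductSpace ℂ H] [CompleteSpace H]
    [NormedAddCommGroup K] [InnerProductSpace ℂ K] [CompleteSpace K]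
    (Φ : V → H →L[ℂ] K) : Prop where
  closure_range :
    (Submodule.span ℂ {k : K | ∃ (v : V) (h : H), Φ v h = k}).topologicalClosure = ⊤
  closure_adjoint_range :
    (Submodule.span ℂ {h : H | ∃ (v : V) (k : K),
      ContinuousLinearMap.adjoint (Φ v) k = h}).topologicalClosure = ⊤

end

/-! Everything rests on one identity: if `⟨T x, T' y⟩ = ⟨x, S y⟩` for the `B`-valued inner products,
then `T ⊗ 1`, `T' ⊗ 1`, `S ⊗ 1` satisfy the same relation on the algebraic tensor products with `H`
(`inner_mapₗ_mapₗ`). Applied to `T = ρ a`, `T' = 1`, `S = ρ (star a)` it makes the induced action of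
`A` star-preserving. Applied to the creation operators `x ↦ v ⊗ x` and `x ↦ w ⊗ x`, with `S = ρ ⟨v,
w⟩`, it is exactly the representation property of `Ind_X Φ`.

The analytic content is boundedness, so that these maps extend to the completions. For `ρ a ⊗ 1`,
positivity of `‖a‖² - star a * a` is made explicit: with `d = ‖a‖ - √(‖a‖² - star a * a)` in `A`,
the defect `‖a‖² ‖t‖² - ‖(ρ a ⊗ 1) t‖²` equals the square `‖‖a‖ t - (ρ d ⊗ 1) t‖²` (`norm_mapₗ_le`).
The bound for creation operators follows from this one with `a = ⟨v, v⟩`.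

Uniqueness holds because elementary tensors are total. For non-degeneracy, `Ind_X Φ(v)⋆ Ind_X Φ(w)`
sends `x ⊗ h` to `⟨v, w⟩ x ⊗ h`; fullness of `V` upgrades `⟨v, w⟩` to an arbitrary `a`, and density
of the span of `A X` finishes. -/

namespace HilbertTensor

/-! ### Operators `T ⊗ 1` between spaces `X ⊗_B H`, and density of elementary tensors. -/

variable {B H X Y Z : Type*} [NonUnitalCStarAlgebra B] [PartialOrder B] [StarOrderedRing B]
  [NormedAddCommGroup X] [NormedSpace ℂ X] [HilbertModule B X]
  [NormedAddCommGroup Y] [NormedSpace ℂ Y] [HilbertModule B Y]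
  [NormedAddCommGroup Z] [NormedSpace ℂ Z] [HilbertModule B Z]
  [NormedAddCommGroup H] [InnerProductSpace ℂ H] [CompleteSpace H]
  (φ : B →⋆ₙₐ[ℂ] (H →L[ℂ] H))

/-- The map `T ⊗ 1` on algebraic tensor products. -/
noncomputable def mapₗ (T : X →ₗ[ℂ] Y) : PreHilbertTensor X φ →ₗ[ℂ] PreHilbertTensor Y φ :=
  LinearMap.rTensor H T

theorem mapₗ_id (t : PreHilbertTensor X φ) : mapₗ φ LinearMap.id t = t :=
  LinearMap.rTensor_id_apply H X t

theorem mapₗ_smul_sub (z : ℂ) (S T : X →ₗ[ℂ] Y) (t : PreHilbertTensor X φ) :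
    mapₗ φ (z • S - T) t = z • mapₗ φ S t - mapₗ φ T t := by
  have : LinearMap.rTensor H (z • S - T) = z • LinearMap.rTensor H S - LinearMap.rTensor H T := by
    rw [LinearMap.rTensor_sub, LinearMap.rTensor_smul]
  exact LinearMap.congr_fun this t

/-- Both sides are sesquilinear, and on elementary tensors the form depends on the module factors
only through their `B`-valued inner products. Neither boundedness nor `B`-linearity of the maps is
needed, so the identity can be used to prove boundedness. -/
theorem inner_mapₗ_mapₗ (T : X →ₗ[ℂ] Z) (T' : Y →ₗ[ℂ] Z) (S : Y →ₗ[ℂ] X)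
    (hS : ∀ x y, inner B (T x) (T' y) = inner B x (S y))
    (s : PreHilbertTensor X φ) (t : PreHilbertTensor Y φ) :
    inner ℂ (mapₗ φ T s) (mapₗ φ T' t) = inner ℂ s (mapₗ φ S t) := by
  change PreHilbertTensor.form Z φ (LinearMap.rTensor H T s) (LinearMap.rTensor H T' t) =
    PreHilbertTensor.form X φ s (LinearMap.rTensor H S t)
  change X ⊗[ℂ] H at s
  change Y ⊗[ℂ] H at t
  induction s with
  | zero => simp
  | add s s' hs hs' => simp only [map_add, LinearMap.add_apply, hs, hs']
  | tmul x h =>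
    induction t with
    | zero => simp
    | add t t' ht ht' => simp only [map_add, ht, ht']
    | tmul y k =>
      simp only [LinearMap.rTensor_tmul, PreHilbertTensor.form_tmul, hS]

/-- Cauchy-Schwarz in `H` together with contractivity of star-homomorphisms. It makes `x ↦ x ⊗ h`
continuous, so density in `X` passes to `X ⊗_B H`. -/
theorem norm_tmul_le (x : X) (h : H) : ‖tmul φ x h‖ ≤ ‖x‖ * ‖h‖ := by
  have h1 : ‖tmul φ x h‖ ^ 2 = (inner ℂ h (φ (inner B x x) h)).re := by
    exact (congrArg (· ^ 2) (Completion.norm_coe (E := PreHilbertTensor X φ) _)).trans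
      (inner_self_eq_norm_sq (𝕜 := ℂ) (E := PreHilbertTensor X φ) _).symm
  have h2 : ‖x‖ ^ 2 = ‖inner B x x‖ := by
    rw [HilbertModule.norm_eq_sqrt_norm_inner_self (A := B), Real.sq_sqrt (norm_nonneg _)]
  refine le_of_sq_le_sq ?_ (by positivity)
  calc ‖tmul φ x h‖ ^ 2 ≤ ‖h‖ * ‖φ (inner B x x) h‖ := by
        rw [h1]
        exact (Complex.re_le_norm _).trans (norm_inner_le_norm _ _)
    _ ≤ ‖h‖ * (‖inner B x x‖ * ‖h‖) := by
        gcongr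
        exact (φ (inner B x x)).le_of_opNorm_le (NonUnitalStarAlgHom.norm_apply_le φ _) h
    _ = (‖x‖ * ‖h‖) ^ 2 := by rw [← h2]; ring

/-- The map `x ↦ x ⊗ h` as a continuous linear map. -/
noncomputable def tmulL (h : H) : X →L[ℂ] HilbertTensor X φ :=
  LinearMap.mkContinuous
    ((Completion.toComplₗᵢ (𝕜 := ℂ) (E := PreHilbertTensor X φ)).toLinearMap ∘ₗ
      (TensorProduct.mk ℂ X H).flip h)
    ‖h‖ fun x => (norm_tmul_le φ x h).trans_eq (mul_comm _ _)

theorem tmulL_apply (x : X) (h : H) : tmulL φ h x = tmul φ x h := rfl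

theorem eq_top_of_tmul_mem {M : Submodule ℂ (HilbertTensor X φ)}
    (hM : IsClosed (M : Set (HilbertTensor X φ))) (h : ∀ x h, tmul φ x h ∈ M) : M = ⊤ := by
  rw [Submodule.eq_top_iff']
  intro ξ
  refine Completion.induction_on ξ hM fun t => ?_
  change X ⊗[ℂ] H at t
  induction t with
  | zero => exact M.zero_mem
  | add s t hs ht =>
    exact (congrArg (· ∈ M) (Completion.coe_add (α := PreHilbertTensor X φ) s t)).mpr
      (M.add_mem hs ht)
  | tmul x k => exact h x k

/-- For fixed `h`, the vectors `x` with `x ⊗ h ∈ M` form a closed subspace containing `D`, hence all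
of `X`. Both halves of non-degeneracy are deduced from this. -/
theorem eq_top_of_dense {D : Set X} (hD : (Submodule.span ℂ D).topologicalClosure = ⊤)
    {M : Submodule ℂ (HilbertTensor X φ)} (hM : IsClosed (M : Set (HilbertTensor X φ)))
    (h : ∀ x ∈ D, ∀ h, tmul φ x h ∈ M) : M = ⊤ := by
  refine eq_top_of_tmul_mem φ hM fun x k => ?_
  have h1 : (Submodule.span ℂ D).topologicalClosure ≤ M.comap (tmulL φ k).toLinearMap :=
    Submodule.topologicalClosure_minimal _ (Submodule.span_le.mpr fun x hx => h x hx k)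
      (hM.preimage (tmulL φ k).continuous)
  rw [hD] at h1
  exact h1 (Submodule.mem_top (x := x))

theorem clm_ext {F : Type*} [NormedAddCommGroup F] [NormedSpace ℂ F]
    {S T : HilbertTensor X φ →L[ℂ] F} (h : ∀ x h, S (tmul φ x h) = T (tmul φ x h)) : S = T := by
  have h1 : (S.toLinearMap.eqLocus T.toLinearMap) = ⊤ :=
    eq_top_of_tmul_mem φ (isClosed_eq S.continuous T.continuous) h
  ext ξ
  exact (h1 ▸ Submodule.mem_top : ξ ∈ S.toLinearMap.eqLocus T.toLinearMap)

/-- The extension of `T ⊗ 1` to the completions. -/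
noncomputable def map (T : X →ₗ[ℂ] Y) (C : ℝ) (hC : ∀ t, ‖mapₗ φ T t‖ ≤ C * ‖t‖) :
    HilbertTensor X φ →L[ℂ] HilbertTensor Y φ :=
  ((mapₗ φ T).mkContinuous C hC).completion

theorem map_coe {T : X →ₗ[ℂ] Y} {C : ℝ} (hC : ∀ t, ‖mapₗ φ T t‖ ≤ C * ‖t‖)
    (t : PreHilbertTensor X φ) : map φ T C hC t = (mapₗ φ T t : PreHilbertTensor Y φ) :=
  ContinuousLinearMap.completion_apply_coe _ _

theorem map_tmul {T : X →ₗ[ℂ] Y} {C : ℝ} (hC : ∀ t, ‖mapₗ φ T t‖ ≤ C * ‖t‖) (x : X) (h : H) :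
    map φ T C hC (tmul φ x h) = tmul φ (T x) h :=
  map_coe φ hC _

/-- The identity for `T ⊗ 1` extends from the dense algebraic tensor products by continuity of inner
products. -/
theorem adjoint_map_comp_map {T : X →ₗ[ℂ] Z} {T' : Y →ₗ[ℂ] Z} {S : Y →ₗ[ℂ] X} {C C' D : ℝ}
    (hC : ∀ t, ‖mapₗ φ T t‖ ≤ C * ‖t‖) (hC' : ∀ t, ‖mapₗ φ T' t‖ ≤ C' * ‖t‖)
    (hD : ∀ t, ‖mapₗ φ S t‖ ≤ D * ‖t‖)
    (hS : ∀ x y, inner B (T x) (T' y) = inner B x (S y)) :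
    ContinuousLinearMap.adjoint (map φ T C hC) ∘L map φ T' C' hC' = map φ S D hD := by
  ext η
  refine ext_inner_left ℂ fun ξ => ?_
  rw [ContinuousLinearMap.comp_apply, ContinuousLinearMap.adjoint_inner_right]
  refine Completion.induction_on₂ ξ η (isClosed_eq (by fun_prop) (by fun_prop)) fun s t => ?_
  rw [map_coe, map_coe, map_coe, Completion.inner_coe, Completion.inner_coe]
  exact inner_mapₗ_mapₗ φ T T' S hS s t

end HilbertTensor

/-! ### A square root without a unit. -/

/-- In the unitization the equation reads `(‖a‖ - d)² = ‖a‖² - star a * a`. Expanding the square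
cancels the scalar `‖a‖²` and leaves a relation inside `A`. -/
theorem exists_isSelfAdjoint_smul_sub_mul_self {A : Type*} [NonUnitalCStarAlgebra A]
    [PartialOrder A] [StarOrderedRing A] (a : A) :
    ∃ d : A, IsSelfAdjoint d ∧ (2 * ‖a‖) • d - d * d = star a * a := by
  have hb : IsSelfAdjoint (star a * a) := IsSelfAdjoint.star_mul_self a
  -- This function solves `2 ‖a‖ f - f² = t` for `t ≤ ‖a‖²`; since `f 0 = 0`, the non-unital
  -- functional calculus applies.
  let f : ℝ → ℝ := fun t => ‖a‖ - √(‖a‖ ^ 2 - t)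
  have hf : Continuous f := by fun_prop
  have hf0 : f 0 = 0 := by simp [f]
  refine ⟨cfcₙ f (star a * a), cfcₙ_predicate f _, ?_⟩
  rw [← cfcₙ_smul (2 * ‖a‖) f _ hf.continuousOn hf0, ← cfcₙ_mul f f _ hf.continuousOn hf0
    hf.continuousOn hf0, ← cfcₙ_sub _ _ _ (by fun_prop) (by simp [hf0]) (by fun_prop)
    (by simp [hf0])]
  refine (cfcₙ_congr fun t ht => ?_).trans (cfcₙ_id ℝ (star a * a))
  -- The spectral bound is what makes the argument of the root nonnegative, hence `√(·)² = ·`.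
  have h1 : t ≤ ‖a‖ ^ 2 := by
    have := norm_apply_le_norm_cfcₙ id (star a * a) ht
    rw [cfcₙ_id ℝ (star a * a), CStarRing.norm_star_mul_self, ← sq] at this
    exact (le_abs_self t).trans this
  have h2 := Real.sq_sqrt (sub_nonneg.mpr h1)
  simp only [f, smul_eq_mul, id]
  linear_combination -h2

/-! ### The induced representations of `A` and of `V`. -/

namespace AdjointableAction

open HilbertTensor

variable {A B V X H : Type*}
  [NonUnitalCStarAlgebra A] [PartialOrder A] [StarOrderedRing A]
  [NonUnitalCStarAlgebra B] [PartialOrder B] [StarOrderedRing B]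
  [NormedAddCommGroup V] [NormedSpace ℂ V] [HilbertModule A V]
  [NormedAddCommGroup X] [NormedSpace ℂ X] [HilbertModule B X]
  [NormedAddCommGroup H] [InnerProductSpace ℂ H] [CompleteSpace H]
  (ρ : AdjointableAction A B X) (φ : B →⋆ₙₐ[ℂ] (H →L[ℂ] H))

theorem inner_apply_apply (a b : A) (x y : X) :
    inner B (ρ a x) (ρ b y) = inner B x (ρ (star a * b) y) := by
  rw [ρ.inner_left, map_mul]
  rfl

/-- Completing the square with the element `d` above: `‖a‖² ‖t‖² - ‖(ρ a ⊗ 1) t‖² = ‖‖a‖ t - (ρ d ⊗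
1) t‖² ≥ 0`. -/
theorem norm_mapₗ_le (a : A) (t : PreHilbertTensor X φ) :
    ‖mapₗ φ (ρ a).toLinearMap t‖ ≤ ‖a‖ * ‖t‖ := by
  obtain ⟨d, hd, hda⟩ := exists_isSelfAdjoint_smul_sub_mul_self a
  let R (c : A) : PreHilbertTensor X φ := mapₗ φ (ρ c).toLinearMap t
  -- All norms that occur thus become values of the functional `c ↦ ⟨t, R c⟩`, where the relation
  -- for `d` can be inserted.
  have hR (b c : A) : inner ℂ (R b) (R c) = inner ℂ t (R (star b * c)) :=
    inner_mapₗ_mapₗ φ _ _ _ (ρ.inner_apply_apply b c) t t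
  have hRa : R (star a * a) = ((2 * ‖a‖ : ℝ) : ℂ) • R d - R (d * d) := by
    refine Eq.trans ?_ (mapₗ_smul_sub φ _ (ρ d).toLinearMap (ρ (d * d)).toLinearMap t)
    rw [← hda, ← Complex.coe_smul]
    simp only [R, map_sub, map_smul]
    rfl
  have h1 : (inner ℂ (R a) (R a)).re = ‖R a‖ ^ 2 := inner_self_eq_norm_sq (𝕜 := ℂ) _
  have h2 : (inner ℂ (R d) (R d)).re = ‖R d‖ ^ 2 := inner_self_eq_norm_sq (𝕜 := ℂ) _
  have h3 : ‖((‖a‖ : ℝ) : ℂ) • t - R d‖ ^ 2 =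
      ‖a‖ ^ 2 * ‖t‖ ^ 2 - 2 * ‖a‖ * (inner ℂ t (R d)).re + ‖R d‖ ^ 2 := by
    rw [norm_sub_sq (𝕜 := ℂ), norm_smul, inner_smul_left]
    simp
    ring
  rw [hR, hRa, inner_sub_right, inner_smul_right, Complex.sub_re, Complex.re_ofReal_mul] at h1
  rw [hR, hd.star_eq] at h2
  refine le_of_sq_le_sq ?_ (by positivity)
  nlinarith [sq_nonneg ‖((‖a‖ : ℝ) : ℂ) • t - R d‖]

/-- The representation of `A` on `X ⊗_B H` induced from `φ`. -/
noncomputable def induced : A →⋆ₙₐ[ℂ] (HilbertTensor X φ →L[ℂ] HilbertTensor X φ) where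
  toFun a := map φ (ρ a).toLinearMap ‖a‖ (ρ.norm_mapₗ_le φ a)
  map_smul' z a := clm_ext φ fun x h => by
    simp only [map_tmul, smul_apply]
    simp [← tmulL_apply]
  map_zero' := clm_ext φ fun x h => by
    simp only [map_tmul]
    simp [← tmulL_apply]
  map_add' a b := clm_ext φ fun x h => by
    simp only [map_tmul, add_apply]
    simp [← tmulL_apply]
  map_mul' a b := clm_ext φ fun x h => by
    simp only [map_tmul, mul_apply_eq_comp]
    simp
  map_star' a := by
    -- With the identity in the second slot this gives the adjoint of `ρ a ⊗ 1`, up to composition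
    -- with the extension of `1 ⊗ 1`, which is removed on elementary tensors.
    have := adjoint_map_comp_map φ (T := (ρ a).toLinearMap) (T' := LinearMap.id) (C' := 1)
      (ρ.norm_mapₗ_le φ a) (fun t => by rw [mapₗ_id, one_mul]) (ρ.norm_mapₗ_le φ (star a))
      (ρ.inner_left a)
    rw [← this, ContinuousLinearMap.star_eq_adjoint]
    refine clm_ext φ fun x h => ?_
    rw [ContinuousLinearMap.comp_apply, map_tmul]
    rfl

theorem induced_tmul (a : A) (x : X) (h : H) :
    ρ.induced φ a (tmul φ x h) = tmul φ (ρ a x) h :=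
  map_tmul φ _ x h

theorem inner_tmul_tmul (v w : V) (x y : X) :
    inner B (InteriorTensor.tmul ρ v x) (InteriorTensor.tmul ρ w y) =
      inner B x (ρ (inner A v w) y) :=
  SemiInnerModule.completion_inner_coe (E := PreInteriorTensor V ρ) (fun _ => rfl) _ _

variable (V) in
/-- The bilinear map `(v, x) ↦ v ⊗ x`. -/
noncomputable def interiorTensorMk : V →ₗ[ℂ] X →ₗ[ℂ] InteriorTensor V ρ :=
  LinearMap.compr₂ (TensorProduct.mk ℂ V X)
    (Completion.toComplₗᵢ (𝕜 := ℂ) (E := PreInteriorTensor V ρ)).toLinearMap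

/-- The squared norm of `v ⊗ t` is `⟨t, (ρ ⟨v, v⟩ ⊗ 1) t⟩`, so the bound for the action of `A`
applies with `‖⟨v, v⟩‖ = ‖v‖²`. -/
theorem norm_mapₗ_interiorTensorMk_le (v : V) (t : PreHilbertTensor X φ) :
    ‖mapₗ φ (ρ.interiorTensorMk V v) t‖ ≤ ‖v‖ * ‖t‖ := by
  refine le_of_sq_le_sq ?_ (by positivity)
  have h2 : ‖v‖ ^ 2 = ‖inner A v v‖ := by
    rw [HilbertModule.norm_eq_sqrt_norm_inner_self (A := A), Real.sq_sqrt (norm_nonneg _)]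
  rw [← inner_self_eq_norm_sq (𝕜 := ℂ), inner_mapₗ_mapₗ φ _ _ _ (ρ.inner_tmul_tmul v v) t t]
  refine (Complex.re_le_norm _).trans ((norm_inner_le_norm _ _).trans ?_)
  have := ρ.norm_mapₗ_le φ (inner A v v) t
  rw [mul_pow, h2]
  nlinarith [norm_nonneg t]

variable (V) in
/-- The representation of `V` on `(X ⊗_B H, V ⊗_A X ⊗_B H)` given by `v ↦ (x ⊗ h ↦ v ⊗ x ⊗ h)`. -/
noncomputable def inducedModule :
    V →ₗ[ℂ] HilbertTensor X φ →L[ℂ] HilbertTensor (InteriorTensor V ρ) φ where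
  toFun v := map φ (ρ.interiorTensorMk V v) ‖v‖ (ρ.norm_mapₗ_interiorTensorMk_le φ v)
  map_add' v w := clm_ext φ fun x h => by
    simp only [map_tmul, add_apply]
    simp [← tmulL_apply]
  map_smul' z v := clm_ext φ fun x h => by
    simp only [map_tmul, smul_apply]
    simp [← tmulL_apply]

theorem inducedModule_tmul (v : V) (x : X) (h : H) :
    ρ.inducedModule V φ v (tmul φ x h) = tmul φ (InteriorTensor.tmul ρ v x) h :=
  map_tmul φ _ x h

theorem isModuleRepresentation_inducedModule :
    IsModuleRepresentation (ρ.induced φ) (ρ.inducedModule V φ) := fun v w =>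
  adjoint_map_comp_map φ _ _ _ (ρ.inner_tmul_tmul v w)

/-! ### Non-degeneracy of the induced representation. -/

variable (V) in
theorem span_interiorTensor_tmul :
    (Submodule.span ℂ {y : InteriorTensor V ρ |
      ∃ v x, InteriorTensor.tmul ρ v x = y}).topologicalClosure = ⊤ := by
  rw [Submodule.eq_top_iff']
  intro y
  refine Completion.induction_on y (Submodule.isClosed_topologicalClosure _) fun t => ?_
  change V ⊗[ℂ] X at t
  refine Submodule.le_topologicalClosure _ ?_
  induction t with
  | zero => exact Submodule.zero_mem _
  | add s t hs ht =>
    exact (congrArg (· ∈ Submodule.span ℂ _)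
      (Completion.coe_add (α := PreInteriorTensor V ρ) s t)).mpr (Submodule.add_mem _ hs ht)
  | tmul v x => exact Submodule.subset_span ⟨v, x, rfl⟩

/-- The range contains every `(v ⊗ x) ⊗ h`, which is total. The adjoint range contains every `⟨v, w⟩
x ⊗ h`, so its closed span contains `a x ⊗ h` for all `a` by fullness, and these are total because
`A X` is. -/
theorem isNondegenerateRepresentation_inducedModule (hV : HilbertModule.IsFull A V)
    (hρ : ρ.IsNondegenerate) : IsNondegenerateRepresentation (ρ.inducedModule V φ) where
  closure_range := by
    refine eq_top_of_dense φ (ρ.span_interiorTensor_tmul V)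
      (Submodule.isClosed_topologicalClosure _) ?_
    rintro _ ⟨v, x, rfl⟩ h
    exact Submodule.le_topologicalClosure _
      (Submodule.subset_span ⟨v, tmul φ x h, ρ.inducedModule_tmul φ v x h⟩)
  closure_adjoint_range := by
    refine eq_top_of_dense φ hρ (Submodule.isClosed_topologicalClosure _) ?_
    rintro _ ⟨a, x, rfl⟩ h
    -- Reading `a x ⊗ h` as a continuous linear function of `a` reduces the claim to `a = ⟨v, w⟩`.
    rw [← induced_tmul]
    have hcont : Continuous fun a : A => ρ.induced φ a (tmul φ x h) :=
      (map_continuous (ρ.induced φ)).clm_apply continuous_const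
    let e : A →ₗ[ℂ] HilbertTensor X φ :=
      { toFun := fun a => ρ.induced φ a (tmul φ x h)
        map_add' := fun a b => by rw [map_add, add_apply]
        map_smul' := fun z a => by rw [map_smul, smul_apply]; rfl }
    have h1 : (Submodule.span ℂ {a : A | ∃ v w : V, inner A v w = a}).topologicalClosure ≤
        (Submodule.span ℂ {ξ | ∃ (v : V) (k : HilbertTensor (InteriorTensor V ρ) φ),
          ContinuousLinearMap.adjoint (ρ.inducedModule V φ v) k =
            ξ}).topologicalClosure.comap e := by
      refine Submodule.topologicalClosure_minimal _ (Submodule.span_le.mpr ?_)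
        ((Submodule.isClosed_topologicalClosure _).preimage hcont)
      rintro _ ⟨v, w, rfl⟩
      refine Submodule.le_topologicalClosure _ (Submodule.subset_span
        ⟨v, ρ.inducedModule V φ w (tmul φ x h), ?_⟩)
      -- The representation property exhibits `⟨v, w⟩ x ⊗ h` as the adjoint at `v` applied to `w ⊗ x
      -- ⊗ h`.
      exact congrArg (· (tmul φ x h)) (ρ.isModuleRepresentation_inducedModule φ v w)
    rw [show Submodule.topologicalClosure _ = _ from hV] at h1
    exact h1 (Submodule.mem_top (x := a))

end AdjointableAction

theorem mainTheorem2 {A B V W X H K : Type*}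
    [NonUnitalCStarAlgebra A] [PartialOrder A] [StarOrderedRing A]
    [NonUnitalCStarAlgebra B] [PartialOrder B] [StarOrderedRing B]
    [NormedAddCommGroup V] [NormedSpace ℂ V] [HilbertModule A V]
    [NormedAddCommGroup W] [NormedSpace ℂ W] [HilbertModule B W]
    [NormedAddCommGroup X] [NormedSpace ℂ X] [HilbertModule B X]
    [NormedAddCommGroup H] [InnerProductSpace ℂ H] [CompleteSpace H]
    [NormedAddCommGroup K] [InnerProductSpace ℂ K] [CompleteSpace K]
    (hV : HilbertModule.IsFull A V) (hW : HilbertModule.IsFull B W)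
    (ρ : AdjointableAction A B X)
    (φ : B →⋆ₙₐ[ℂ] (H →L[ℂ] H)) (Φ : W → H →L[ℂ] K)
    (hΦ : IsModuleRepresentation φ Φ) (hΦ' : IsNondegenerateRepresentation Φ) :
    ∃ (indφ : A →⋆ₙₐ[ℂ] (HilbertTensor X φ →L[ℂ] HilbertTensor X φ))
      (indΦ : V →ₗ[ℂ] HilbertTensor X φ →L[ℂ] HilbertTensor (InteriorTensor V ρ) φ),
      -- the Rieffel-induced representation of `A`
      (∀ (a : A) (x : X) (h : H),
        indφ a (HilbertTensor.tmul φ x h) = HilbertTensor.tmul φ (ρ a x) h) ∧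
      -- the formula `v ↦ (x ⊗ h ↦ v ⊗ x ⊗ h)` and the uniqueness of its extension
      (∀ (v : V) (x : X) (h : H),
        indΦ v (HilbertTensor.tmul φ x h) =
          HilbertTensor.tmul φ (InteriorTensor.tmul ρ v x) h) ∧
      (∀ (v : V) (T : HilbertTensor X φ →L[ℂ] HilbertTensor (InteriorTensor V ρ) φ),
        (∀ (x : X) (h : H), T (HilbertTensor.tmul φ x h) =
          HilbertTensor.tmul φ (InteriorTensor.tmul ρ v x) h) → T = indΦ v) ∧
      IsModuleRepresentation indφ indΦ ∧
      (ρ.IsNondegenerate → IsNondegenerateRepresentation indΦ) := by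
  refine ⟨ρ.induced φ, ρ.inducedModule V φ, ρ.induced_tmul φ, ρ.inducedModule_tmul φ,
    fun v T hT => HilbertTensor.clm_ext φ fun x h => ?_,
    ρ.isModuleRepresentation_inducedModule φ,
    ρ.isNondegenerateRepresentation_inducedModule φ hV⟩
  rw [hT, ρ.inducedModule_tmul]
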